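/- **Setting.** Let $N,m\in\mathbb N$. Let $\Omega_x=[x_{\min},x_{\max}]$, $\Omega_y=[y_{\min},y_{\max}]$, $\Omega_{z,i}=[z_{i,\min},z_{i,\max}]$ ($i=1,\dots,N$) be non-empty compact real intervals and $\Omega_{\boldsymbol z}=\prod_{i=1}^N\Omega_{z,i}\subset\mathbb R^N$. Let $\theta_0\in\mathbb R^m$ (the true parameter) and $\Theta\subseteq\mathbb R^m$ (the deception parameters). The leader $X$, the middle-level follower $Y$ and the bottom-level followers $Z_1,\dots,Z_N$ choose $x\in\Omega_x$, $y\in\Omega_y$, $z_i\in\Omega_{z,i}$ and have the utilities $$U_X(x,y,\boldsymbol z,\theta)=B(x,\theta)+f_1(y,\boldsymbol z)\,x,\qquad U_Y(x,y,\theta)=f_2(x,\theta)\,y+f_3(x),\qquad U_{Z_i}(x,y,\boldsymbol z,\theta)=f_{4_i}(x,y,z_i,\boldsymbol z_{-i},\theta),$$ where $B,f_1,f_2,f_3,f_{4_i}$ are real-valued functions. Put $F(x,y,\boldsymbol z,\theta)=\bigl(-\partial f_{4_i}/\partial z_i(x,y,\boldsymbol z,\theta)\bigr)_{i=1}^N\in\mathbb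 R^N$. Norms on $\mathbb R^N$ are Euclidean, norms of matrices are operator norms, and derivatives at end points of intervals are one-sided. For $\theta\in\Theta$, a Hyper Nash equilibrium (HNE) of the game $\mathcal G(\theta_0,\theta)$ is a profile $(x^\diamond,y^\diamond,\boldsymbol z^\diamond)\in\Omega_x\times\Omega_y\times\Omega_{\boldsymbol z}$ with $$x^\diamond\in\arg\max_{x\in\Omega_x}U_X(x,y^\diamond,\boldsymbol z^\diamond,\theta_0),\quad y^\diamond\in\arg\max_{y\in\Omega_y}U_Y(x^\diamond,y,\theta),\quad z_i^\diamond\in\arg\max_{z_i\in\Omega_{z,i}}U_{Z_i}(x^\diamond,y^\diamond,z_i,\boldsymbol z^\diamond_{-i},\theta)\ \ (i=1,\dots,N).$$ **Assumptions.** 1. $U_X(\cdot,\theta_0)$ and, for each $\theta\in\Theta$, $U_Y(\cdot,\theta)$ and $U_{Z_i}(\cdot,\theta)$ are continuously differentiable on the set of strategy profiles and concave in the player's own decision ($x$, $y$, $z_i$, respectively). The set $\Theta$ is finite. 2. For each $\theta\in\Theta$, $x\in\Omega_x$, $y\in\Omega_y$, the map $F(x,y,\cdot,\theta)$ on $\Omega_{\boldsymbol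 z}$ is $\mu$-strongly monotone for some $\mu>0$, that is, $\langle F(x,y,\boldsymbol z,\theta)-F(x,y,\hat{\boldsymbol z},\theta),\boldsymbol z-\hat{\boldsymbol z}\rangle\ge\mu\|\boldsymbol z-\hat{\boldsymbol z}\|^2$, and it is Lipschitz. For each $\theta\in\Theta$, $F(\cdot,\cdot,\cdot,\theta)$ is continuously differentiable on $\Omega_x\times\Omega_y\times\Omega_{\boldsymbol z}$. 3. (i) $x\mapsto\nabla_xB(x,\theta_0)$ is Lipschitz on $\Omega_x$ and, for each $y\in\Omega_y$, $\boldsymbol z\mapsto\nabla_{\boldsymbol z}f_1(y,\boldsymbol z)$ is Lipschitz on $\Omega_{\boldsymbol z}$. (ii) For each $\theta\in\Theta$, $f_2(\cdot,\theta)$ has finitely many zeros in $\Omega_x$. (iii) There is an o-minimal structure on the real field in which, for every $\theta\in\Theta$, the graph of $F(\cdot,\cdot,\cdot,\theta)$ over $\Omega_x\times\Omega_y\times\Omega_{\boldsymbol z}$ is definable, and there is a constant $L_F$ such that the partial Jacobians of $F$ in $x$ and in $\boldsymbol z$ satisfy $\|\mathrm J_xF(x,y,\boldsymbol z,\theta)-\mathrm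 J_xF(x,y,\hat{\boldsymbol z},\theta)\|\le L_F\|\boldsymbol z-\hat{\boldsymbol z}\|$ and $\|\mathrm J_{\boldsymbol z}F(x,y,\boldsymbol z,\theta)-\mathrm J_{\boldsymbol z}F(x,y,\hat{\boldsymbol z},\theta)\|\le L_F\|\boldsymbol z-\hat{\boldsymbol z}\|$ for all $\theta\in\Theta$, $x\in\Omega_x$, $y\in\Omega_y$, $\boldsymbol z,\hat{\boldsymbol z}\in\Omega_{\boldsymbol z}$. **Claim.** Under these assumptions, for every $\theta\in\Theta$ the game $\mathcal G(\theta_0,\theta)$ has a Hyper Nash equilibrium. -/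

import Mathlib

open Set

/-- An o-minimal structure on the real field: for every `n` a Boolean algebra of subsets of `ℝⁿ`,
stable under products with `ℝ` on either side and under the projection that forgets the last
coordinate, containing all real algebraic sets, and such that its members in dimension one are
exactly finite unions of intervals (an interval is an order-connected subset of `ℝ`; points, rays,
the empty set and the line are included).  That conversely every interval belongs to the structure
follows from the other axioms. -/
structure OMinimalStructure where
  /-- the definable subsets of `ℝⁿ` -/
  sets : (n : ℕ) → Set (Set (Fin n → ℝ))
  compl_mem : ∀ {n : ℕ} {A : Set (Fin n → ℝ)}, A ∈ sets n → Aᶜ ∈ sets n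
  union_mem : ∀ {n : ℕ} {A B : Set (Fin n → ℝ)}, A ∈ sets n → B ∈ sets n → A ∪ B ∈ sets n
  prod_left_mem : ∀ {n : ℕ} {A : Set (Fin n → ℝ)}, A ∈ sets n →
    {v : Fin (n + 1) → ℝ | Fin.tail v ∈ A} ∈ sets (n + 1)
  prod_right_mem : ∀ {n : ℕ} {A : Set (Fin n → ℝ)}, A ∈ sets n →
    {v : Fin (n + 1) → ℝ | Fin.init v ∈ A} ∈ sets (n + 1)
  proj_mem : ∀ {n : ℕ} {A : Set (Fin (n + 1) → ℝ)}, A ∈ sets (n + 1) →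
    {u : Fin n → ℝ | ∃ t : ℝ, (Fin.snoc u t : Fin (n + 1) → ℝ) ∈ A} ∈ sets n
  algebraic_mem : ∀ {n : ℕ} (p : MvPolynomial (Fin n) ℝ),
    {v : Fin n → ℝ | MvPolynomial.eval v p = 0} ∈ sets n
  tame : ∀ {A : Set (Fin 1 → ℝ)}, A ∈ sets 1 →
    ∃ T : Set (Set ℝ), T.Finite ∧ (∀ I ∈ T, I.OrdConnected) ∧ {t : ℝ | ![t] ∈ A} = ⋃₀ T

/-- The data of the three-party game with deception parameters in `ℝᵐ` and `N` bottom-level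
players.  Only the values of the functions on the strategy sets matter.  The index `i` of `f₄`
refers to the bottom-level player `Z_i`; its argument `z` is the whole profile
`(z_i, z_{-i})`. -/
structure DeceptionGame (N m : ℕ) where
  xmin : ℝ
  xmax : ℝ
  x_le : xmin ≤ xmax
  ymin : ℝ
  ymax : ℝ
  y_le : ymin ≤ ymax
  zmin : Fin N → ℝ
  zmax : Fin N → ℝ
  z_le : ∀ i, zmin i ≤ zmax i
  /-- the true parameter -/
  θ₀ : EuclideanSpace ℝ (Fin m)
  /-- the set of deception parameters -/
  Θ : Set (EuclideanSpace ℝ (Fin m))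
  B : ℝ → EuclideanSpace ℝ (Fin m) → ℝ
  f₁ : ℝ → EuclideanSpace ℝ (Fin N) → ℝ
  f₂ : ℝ → EuclideanSpace ℝ (Fin m) → ℝ
  f₃ : ℝ → ℝ
  f₄ : Fin N → ℝ → ℝ → EuclideanSpace ℝ (Fin N) → EuclideanSpace ℝ (Fin m) → ℝ

/-- The profile `(t, z_{-i})`: the `i`-th coordinate of `z` is replaced by `t`. -/
def replaceCoord {N : ℕ} (z : EuclideanSpace ℝ (Fin N)) (i : Fin N) (t : ℝ) :
    EuclideanSpace ℝ (Fin N) :=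
  WithLp.toLp 2 (Function.update (WithLp.ofLp z) i t)

namespace DeceptionGame

variable {N m : ℕ} (G : DeceptionGame N m)

/-- strategy set of the leader `X` -/
def Ωx : Set ℝ := Icc G.xmin G.xmax

/-- strategy set of the middle-level follower `Y` -/
def Ωy : Set ℝ := Icc G.ymin G.ymax

/-- strategy set of the bottom-level follower `Z_i` -/
def Ωzi (i : Fin N) : Set ℝ := Icc (G.zmin i) (G.zmax i)

/-- set of strategy profiles of the bottom-level followers -/
def Ωz : Set (EuclideanSpace ℝ (Fin N)) := {z | ∀ i, z i ∈ G.Ωzi i}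

/-- utility of the leader -/
def UX (x y : ℝ) (z : EuclideanSpace ℝ (Fin N)) (θ : EuclideanSpace ℝ (Fin m)) : ℝ :=
  G.B x θ + G.f₁ y z * x

/-- utility of the middle-level follower -/
def UY (x y : ℝ) (θ : EuclideanSpace ℝ (Fin m)) : ℝ :=
  G.f₂ x θ * y + G.f₃ x

/-- utility of the bottom-level follower `Z_i` -/
def UZ (i : Fin N) (x y : ℝ) (z : EuclideanSpace ℝ (Fin N)) (θ : EuclideanSpace ℝ (Fin m)) : ℝ :=
  G.f₄ i x y z θ

/-- Hyper Nash equilibrium of the game with true parameter `G.θ₀` and announced parameter `θ`. -/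
def IsHNE (θ : EuclideanSpace ℝ (Fin m)) (x y : ℝ) (z : EuclideanSpace ℝ (Fin N)) : Prop :=
  (x ∈ G.Ωx ∧ IsMaxOn (fun x' => G.UX x' y z G.θ₀) G.Ωx x) ∧
  (y ∈ G.Ωy ∧ IsMaxOn (fun y' => G.UY x y' θ) G.Ωy y) ∧
  ∀ i, z i ∈ G.Ωzi i ∧ IsMaxOn (fun t => G.UZ i x y (replaceCoord z i t) θ) (G.Ωzi i) (z i)

/-- The utilities are concave in the player's own decision and continuously differentiable on the
set of strategy profiles, and there are finitely many deception parameters. -/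
structure ConcaveSmooth : Prop where
  UX_concave : ∀ y ∈ G.Ωy, ∀ z ∈ G.Ωz, ConcaveOn ℝ G.Ωx (fun x => G.UX x y z G.θ₀)
  UY_concave : ∀ θ ∈ G.Θ, ∀ x ∈ G.Ωx, ConcaveOn ℝ G.Ωy (fun y => G.UY x y θ)
  UZ_concave : ∀ θ ∈ G.Θ, ∀ i, ∀ x ∈ G.Ωx, ∀ y ∈ G.Ωy, ∀ z ∈ G.Ωz,
    ConcaveOn ℝ (G.Ωzi i) (fun t => G.UZ i x y (replaceCoord z i t) θ)
  UX_smooth : ContDiffOn ℝ 1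
    (fun p : ℝ × ℝ × EuclideanSpace ℝ (Fin N) => G.UX p.1 p.2.1 p.2.2 G.θ₀)
    (G.Ωx ×ˢ G.Ωy ×ˢ G.Ωz)
  UY_smooth : ∀ θ ∈ G.Θ, ContDiffOn ℝ 1 (fun p : ℝ × ℝ => G.UY p.1 p.2 θ) (G.Ωx ×ˢ G.Ωy)
  UZ_smooth : ∀ θ ∈ G.Θ, ∀ i, ContDiffOn ℝ 1
    (fun p : ℝ × ℝ × EuclideanSpace ℝ (Fin N) => G.UZ i p.1 p.2.1 p.2.2 θ)
    (G.Ωx ×ˢ G.Ωy ×ˢ G.Ωz)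
  finite_Θ : G.Θ.Finite

/-- The pseudogradient `F(x, y, z, θ) = col (-∂f₄ᵢ/∂zᵢ)ᵢ`; the partial derivatives are taken
within the strategy intervals, so they are one-sided at end points. -/
noncomputable def F (x y : ℝ) (z : EuclideanSpace ℝ (Fin N)) (θ : EuclideanSpace ℝ (Fin m)) :
    EuclideanSpace ℝ (Fin N) :=
  WithLp.toLp 2 fun i =>
    -derivWithin (fun t => G.f₄ i x y (replaceCoord z i t) θ) (G.Ωzi i) (z i)

/-- The pseudogradient is strongly monotone and Lipschitz in `z`, and it is continuously
differentiable in `(x, y, z)`. -/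
structure StronglyMonotonePG : Prop where
  strongly_monotone : ∀ θ ∈ G.Θ, ∀ x ∈ G.Ωx, ∀ y ∈ G.Ωy, ∃ μ : ℝ, 0 < μ ∧
    ∀ z ∈ G.Ωz, ∀ z' ∈ G.Ωz,
      μ * ‖z - z'‖ ^ 2 ≤ inner ℝ (G.F x y z θ - G.F x y z' θ) (z - z')
  lipschitz : ∀ θ ∈ G.Θ, ∀ x ∈ G.Ωx, ∀ y ∈ G.Ωy, ∃ κ : NNReal,
    LipschitzOnWith κ (fun z => G.F x y z θ) G.Ωz
  smooth : ∀ θ ∈ G.Θ, ContDiffOn ℝ 1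
    (fun p : ℝ × ℝ × EuclideanSpace ℝ (Fin N) => G.F p.1 p.2.1 p.2.2 θ)
    (G.Ωx ×ˢ G.Ωy ×ˢ G.Ωz)

/-- The partial Jacobian of `F` in `x`, an `N × 1` matrix written as a column vector. -/
noncomputable def J₁F (x y : ℝ) (z : EuclideanSpace ℝ (Fin N)) (θ : EuclideanSpace ℝ (Fin m)) :
    EuclideanSpace ℝ (Fin N) :=
  WithLp.toLp 2 fun i => derivWithin (fun s => G.F s y z θ i) G.Ωx x

/-- The partial Jacobian of `F` in `z`, as the operator on Euclidean space given by the matrix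
`(∂Fᵢ/∂zⱼ)ᵢⱼ`, so that its norm is the operator norm of that matrix. -/
noncomputable def J₃F (x y : ℝ) (z : EuclideanSpace ℝ (Fin N)) (θ : EuclideanSpace ℝ (Fin m)) :
    EuclideanSpace ℝ (Fin N) →L[ℝ] EuclideanSpace ℝ (Fin N) :=
  Matrix.toEuclideanCLM (n := Fin N) (𝕜 := ℝ) (Matrix.of fun i j =>
    derivWithin (fun t => G.F x y (replaceCoord z j t) θ i) (G.Ωzi j) (z j))

/-- The gradient of `f₁(y, z)` in `z`. -/
noncomputable def gradf₁ (y : ℝ) (z : EuclideanSpace ℝ (Fin N)) : EuclideanSpace ℝ (Fin N) :=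
  WithLp.toLp 2 fun j => derivWithin (fun t => G.f₁ y (replaceCoord z j t)) (G.Ωzi j) (z j)

/-- The graph of `F(·, ·, ·, θ)` over the set of strategy profiles, as a subset of
`ℝ^(1 + 1 + N) × ℝᴺ`. -/
def graphF (θ : EuclideanSpace ℝ (Fin m)) : Set (Fin (N + 1 + 1 + N) → ℝ) :=
  {v | ∃ x ∈ G.Ωx, ∃ y ∈ G.Ωy, ∃ z ∈ G.Ωz,
    v = Fin.append (Matrix.vecCons x (Matrix.vecCons y (WithLp.ofLp z)))
      (WithLp.ofLp (G.F x y z θ))}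

/-- The gradients of `B` and `f₁` are Lipschitz, `f₂` has finitely many zeros in the leader's
strategy set, the pseudogradient is definable, and its partial Jacobians in `x` and in `z` are
Lipschitz in `z`. -/
structure TameRegular : Prop where
  B_grad_lipschitz : ∃ L : NNReal, LipschitzOnWith L
    (fun x => derivWithin (fun s => G.B s G.θ₀) G.Ωx x) G.Ωx
  f₁_grad_lipschitz : ∀ y ∈ G.Ωy, ∃ L : NNReal, LipschitzOnWith L (fun z => G.gradf₁ y z) G.Ωz
  f₂_zeros_finite : ∀ θ ∈ G.Θ, {x ∈ G.Ωx | G.f₂ x θ = 0}.Finite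
  F_definable : ∃ S : OMinimalStructure, ∀ θ ∈ G.Θ, G.graphF θ ∈ S.sets (N + 1 + 1 + N)
  F_jacobian_lipschitz : ∃ L : ℝ, ∀ θ ∈ G.Θ, ∀ x ∈ G.Ωx, ∀ y ∈ G.Ωy,
    ∀ z ∈ G.Ωz, ∀ z' ∈ G.Ωz,
      ‖G.J₁F x y z θ - G.J₁F x y z' θ‖ ≤ L * ‖z - z'‖ ∧
      ‖G.J₃F x y z θ - G.J₃F x y z' θ‖ ≤ L * ‖z - z'‖

end DeceptionGame

/-! The argument is a connectedness argument in the plane of the decisions of `X` and `Y`. Given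
`(x, y)`, the bottom level has exactly one Nash equilibrium: concavity turns equilibrium into a
variational inequality for `F`, and strong monotonicity with the Lipschitz bound solves it uniquely.
The optimal replies of `Y` to `x` form a nonempty convex set. Over the graph of this reply
correspondence, let `A` be the points where the leader cannot gain by decreasing `x` and `B` those
where increasing `x` does not help. Concavity of the leader's utility puts every point in `A` or
`B`; points over `xmin` lie in `A`, points over `xmax` in `B`, and both sets are compact. Hence `A`
and `B` meet, and by uniqueness of the bottom-level reply a common point is an equilibrium. No
fixed-point theorem beyond Banach's is needed. -/

/-- Two compact planar sets that cover the graph of a correspondence with nonempty connected values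
over an interval, one of them meeting the left end and the other the right end, meet. -/
theorem inter_nonempty_of_cover_graph {a b : ℝ} (hab : a ≤ b) {Y : ℝ → Set ℝ} {A B : Set (ℝ × ℝ)}
    (hA : IsCompact A) (hB : IsCompact B)
    (hYne : ∀ x ∈ Icc a b, (Y x).Nonempty) (hY : ∀ x ∈ Icc a b, IsPreconnected (Y x))
    (hcover : ∀ x ∈ Icc a b, ∀ y ∈ Y x, (x, y) ∈ A ∪ B)
    (hAY : ∀ p ∈ A, p.2 ∈ Y p.1) (hBY : ∀ p ∈ B, p.2 ∈ Y p.1)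
    (ha : ∃ y, (a, y) ∈ A) (hb : ∃ y, (b, y) ∈ B) : (A ∩ B).Nonempty := by
  obtain ⟨ya, ha⟩ := ha
  obtain ⟨yb, hb⟩ := hb
  -- Connectedness is used twice: in the base, the closed projections of `A` and `B` share some `x`;
  -- in the fibre `Y x`, the closed slices of `A` and `B` then meet.
  obtain ⟨x, hx, ⟨⟨x₁, y₁⟩, hp₁, rfl⟩, ⟨⟨x₂, y₂⟩, hp₂, rfl⟩⟩ :=
    isPreconnected_closed_iff.1 (isPreconnected_Icc (a := a) (b := b)) (Prod.fst '' A)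
      (Prod.fst '' B) (hA.image continuous_fst).isClosed (hB.image continuous_fst).isClosed
      (fun x hx => by
        obtain ⟨y, hy⟩ := hYne x hx
        exact (hcover x hx y hy).imp (fun h => ⟨_, h, rfl⟩) (fun h => ⟨_, h, rfl⟩))
      ⟨a, left_mem_Icc.2 hab, _, ha, rfl⟩ ⟨b, right_mem_Icc.2 hab, _, hb, rfl⟩
  have hc : Continuous fun y : ℝ => (x₂, y) := by fun_prop
  obtain ⟨y, -, hyA, hyB⟩ := isPreconnected_closed_iff.1 (hY _ hx) _ _
    (hA.isClosed.preimage hc) (hB.isClosed.preimage hc) (fun y hy => hcover _ hx y hy)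
    ⟨y₁, hAY _ hp₁, hp₁⟩ ⟨y₂, hBY _ hp₂, hp₂⟩
  exact ⟨_, hyA, hyB⟩

/-- A compact set cut out by a family of weak inequalities between continuous functions is
compact. -/
theorem IsCompact.setOf_forall_le {α : Type*} [TopologicalSpace α] [T2Space α] {ι : Sort*}
    {K : Set α} (hK : IsCompact K) {f g : ι → α → ℝ} (hf : ∀ i, ContinuousOn (f i) K)
    (hg : ∀ i, ContinuousOn (g i) K) : IsCompact {p ∈ K | ∀ i, f i p ≤ g i p} := by
  have h : {p ∈ K | ∀ i, f i p ≤ g i p} = K ∩ ⋂ i, {p ∈ K | f i p ≤ g i p} := by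
    ext p
    simp only [mem_ofPred_eq, mem_inter_iff, mem_iInter]
    exact ⟨fun h => ⟨h.1, fun i => ⟨h.1, h.2 i⟩⟩, fun h => ⟨h.1, fun i => (h.2 i).2⟩⟩
  rw [h]
  exact hK.inter_right (isClosed_iInter fun i => hK.isClosed.isClosed_le (hf i) (hg i))

/-- A concave function cannot be improved both to the left and to the right of a point. -/
theorem ConcaveOn.forall_min_le_or_forall_max_le {a b x : ℝ} {f : ℝ → ℝ}
    (hf : ConcaveOn ℝ (Icc a b) f) :
    (∀ t : Icc a b, f (min t x) ≤ f x) ∨ ∀ t : Icc a b, f (max t x) ≤ f x := by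
  by_contra! h
  obtain ⟨⟨⟨s, hs⟩, h₁⟩, ⟨⟨t, ht⟩, h₂⟩⟩ := h
  dsimp only at h₁ h₂
  -- A strict gain is impossible when the truncation returns `x` itself, so the two deviations lie
  -- strictly on either side of `x`.
  have hsx : s < x := by
    by_contra! hc
    rw [min_eq_right hc] at h₁
    exact h₁.false
  have hxt : x < t := by
    by_contra! hc
    rw [max_eq_right hc] at h₂
    exact h₂.false
  rw [min_eq_left hsx.le] at h₁
  rw [max_eq_left hxt.le] at h₂
  exact (lt_min h₁ h₂).not_ge (hf.min_le_of_mem_Icc hs ht ⟨hsx.le, hxt.le⟩)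

/-! ### First-order conditions on an interval -/

theorem IsMaxOn.derivWithin_mul_sub_nonpos {a b s t : ℝ} {f : ℝ → ℝ}
    (hmax : IsMaxOn f (Icc a b) t) (hf : DifferentiableWithinAt ℝ f (Icc a b) t)
    (ht : t ∈ Icc a b) (hs : s ∈ Icc a b) : derivWithin f (Icc a b) t * (s - t) ≤ 0 := by
  have h := hmax.localize.hasFDerivWithinAt_nonpos hf.hasDerivWithinAt.hasFDerivWithinAt
    (sub_mem_posTangentConeAt_of_segment_subset ((convex_Icc a b).segment_subset ht hs))
  simpa [mul_comm] using h

/-- A concave function lies below its tangent line at `t`, and the sign condition keeps that line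
below `f t` on the interval. -/
theorem ConcaveOn.isMaxOn_of_derivWithin_mul_sub_nonpos {a b t : ℝ} {f : ℝ → ℝ}
    (hconc : ConcaveOn ℝ (Icc a b) f) (hf : DifferentiableWithinAt ℝ f (Icc a b) t)
    (ht : t ∈ Icc a b) (h : ∀ s ∈ Icc a b, derivWithin f (Icc a b) t * (s - t) ≤ 0) :
    IsMaxOn f (Icc a b) t := by
  intro s hs
  change f s ≤ f t
  have h' := h s hs
  rcases lt_trichotomy s t with hst | rfl | hst
  · have hslope := hconc.derivWithin_le_slope hs ht hst hf
    rw [slope_def_field, le_div_iff₀ (sub_pos.2 hst)] at hslope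
    linarith
  · exact le_rfl
  · have hslope := hconc.slope_le_derivWithin ht hs hst hf
    rw [slope_def_field, div_le_iff₀ (sub_pos.2 hst)] at hslope
    linarith

/-! ### Variational inequalities over a box -/

theorem replaceCoord_eq_add_smul {N : ℕ} (z : EuclideanSpace ℝ (Fin N)) (i : Fin N) (t : ℝ) :
    replaceCoord z i t = z + (t - z i) • EuclideanSpace.single i (1 : ℝ) := by
  ext j
  by_cases h : j = i
  · subst h; simp [replaceCoord]
  · simp [replaceCoord, h]

@[simp]
theorem replaceCoord_self {N : ℕ} (z : EuclideanSpace ℝ (Fin N)) (i : Fin N) :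
    replaceCoord z i (z i) = z := by
  simp [replaceCoord_eq_add_smul]

/-- The projection of Euclidean space onto a box. -/
noncomputable def projBox {N : ℕ} {a b : Fin N → ℝ} (hab : ∀ i, a i ≤ b i)
    (w : EuclideanSpace ℝ (Fin N)) : EuclideanSpace ℝ (Fin N) :=
  WithLp.toLp 2 fun i => (projIcc (a i) (b i) (hab i) (w i) : ℝ)

theorem norm_projBox_sub_projBox_le {N : ℕ} {a b : Fin N → ℝ} (hab : ∀ i, a i ≤ b i)
    (v w : EuclideanSpace ℝ (Fin N)) : ‖projBox hab v - projBox hab w‖ ≤ ‖v - w‖ := by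
  rw [EuclideanSpace.norm_eq, EuclideanSpace.norm_eq]
  refine Real.sqrt_le_sqrt (Finset.sum_le_sum fun i _ => ?_)
  exact pow_le_pow_left₀ (norm_nonneg _) (abs_projIcc_sub_projIcc (hab i)) 2

/-- If the projected step returns to `t`, either `c = 0` or `t` is an end point and the step `-γ *
c` points out of the interval. -/
theorem mul_sub_nonneg_of_projIcc_eq {a b γ c s t : ℝ} (hab : a ≤ b) (hγ : 0 < γ)
    (h : (projIcc a b hab (t - γ * c) : ℝ) = t) (hs : s ∈ Icc a b) : 0 ≤ c * (s - t) := by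
  rw [coe_projIcc] at h
  suffices 0 ≤ γ * c * (s - t) by
    rw [mul_assoc] at this
    exact nonneg_of_mul_nonneg_right this hγ
  generalize γ * c = d at h
  obtain ⟨h₁, h₂⟩ := hs
  rcases le_total b (t - d) with hb | hb
  · rw [min_eq_left hb, max_eq_right hab] at h
    nlinarith
  · rw [min_eq_right hb] at h
    rcases le_total a (t - d) with ha | ha
    · rw [max_eq_right ha] at h
      have : d = 0 := by linarith
      simp [this]
    · rw [max_eq_left ha] at h
      nlinarith

/-- A strongly monotone Lipschitz map solves the variational inequality over a box, in the
coordinatewise form. -/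
theorem exists_solution_variationalInequality_box {N : ℕ} {a b : Fin N → ℝ}
    (hab : ∀ i, a i ≤ b i) {Φ : EuclideanSpace ℝ (Fin N) → EuclideanSpace ℝ (Fin N)} {μ : ℝ}
    (hμ : 0 < μ)
    (hmono : ∀ z ∈ {z : EuclideanSpace ℝ (Fin N) | ∀ i, z i ∈ Icc (a i) (b i)},
      ∀ z' ∈ {z : EuclideanSpace ℝ (Fin N) | ∀ i, z i ∈ Icc (a i) (b i)},
      μ * ‖z - z'‖ ^ 2 ≤ inner ℝ (Φ z - Φ z') (z - z'))
    {κ : NNReal} (hlip : LipschitzOnWith κ Φ {z | ∀ i, z i ∈ Icc (a i) (b i)}) :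
    ∃ z : EuclideanSpace ℝ (Fin N), (∀ i, z i ∈ Icc (a i) (b i)) ∧
      ∀ i, ∀ s ∈ Icc (a i) (b i), 0 ≤ Φ z i * (s - z i) := by
  set Q : Set (EuclideanSpace ℝ (Fin N)) := {z | ∀ i, z i ∈ Icc (a i) (b i)} with hQ
  have hclosed : IsClosed Q := by
    rw [hQ, ofPred_forall]
    exact isClosed_iInter fun i => isClosed_Icc.preimage (by fun_prop)
  -- The squared contraction factor is at most `1 - 2γμ + γ²K`, minimal at `γ = μ / K`. Using `K`
  -- instead of `κ ^ 2` keeps it positive when `κ = 0` and makes `1 - μ ^ 2 / K` nonnegative.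
  set K : ℝ := κ ^ 2 + μ ^ 2 with hK
  have hKpos : 0 < K := by positivity
  set γ : ℝ := μ / K with hγ
  have hγpos : 0 < γ := by positivity
  have hr : 0 ≤ 1 - μ ^ 2 / K := by
    rw [sub_nonneg, div_le_one hKpos, hK]
    nlinarith [sq_nonneg (κ : ℝ)]
  have hr1 : 1 - μ ^ 2 / K < 1 := by
    have : 0 < μ ^ 2 / K := by positivity
    linarith
  -- The projected gradient step; its fixed points solve the inequality, and Banach's theorem
  -- provides one.
  let T : EuclideanSpace ℝ (Fin N) → EuclideanSpace ℝ (Fin N) :=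
    fun z => projBox hab (z - γ • Φ z)
  have hmaps : MapsTo T Q Q := fun z _ i => (projIcc (a i) (b i) (hab i) _).2
  have hT : ∀ z ∈ Q, ∀ z' ∈ Q, ‖T z - T z'‖ ≤ √(1 - μ ^ 2 / K) * ‖z - z'‖ := by
    intro z hz z' hz'
    refine (norm_projBox_sub_projBox_le hab _ _).trans ?_
    refine abs_le_of_sq_le_sq' ?_ (by positivity) |>.2
    have hsplit : z - γ • Φ z - (z' - γ • Φ z') = (z - z') - γ • (Φ z - Φ z') := by
      rw [smul_sub]; abel
    have hl : ‖Φ z - Φ z'‖ ^ 2 ≤ κ ^ 2 * ‖z - z'‖ ^ 2 := by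
      rw [← mul_pow]
      refine pow_le_pow_left₀ (norm_nonneg _) ?_ 2
      simpa [dist_eq_norm] using hlip.dist_le_mul z hz z' hz'
    have hm := hmono z hz z' hz'
    rw [hsplit, norm_sub_sq_real, mul_pow, Real.sq_sqrt hr, norm_smul, inner_smul_right,
      real_inner_comm, mul_pow, Real.norm_eq_abs, sq_abs]
    have h₁ : γ ^ 2 * ‖Φ z - Φ z'‖ ^ 2 ≤ γ ^ 2 * (K * ‖z - z'‖ ^ 2) := by
      refine mul_le_mul_of_nonneg_left (hl.trans ?_) (sq_nonneg γ)
      exact mul_le_mul_of_nonneg_right (by rw [hK]; nlinarith) (sq_nonneg _)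
    have h₂ : γ * (μ * ‖z - z'‖ ^ 2) ≤ γ * inner ℝ (Φ z - Φ z') (z - z') :=
      mul_le_mul_of_nonneg_left hm hγpos.le
    have h₃ : γ ^ 2 * (K * ‖z - z'‖ ^ 2) = μ ^ 2 / K * ‖z - z'‖ ^ 2 := by
      rw [hγ]; field_simp
    have h₄ : γ * (μ * ‖z - z'‖ ^ 2) = μ ^ 2 / K * ‖z - z'‖ ^ 2 := by
      rw [hγ]; field_simp
    linarith
  have hcontr : ContractingWith (√(1 - μ ^ 2 / K)).toNNReal (hmaps.restrict T Q Q) := by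
    refine ⟨?_, LipschitzWith.of_dist_le_mul fun z z' => ?_⟩
    · rw [Real.toNNReal_lt_one]
      exact (Real.sqrt_lt' one_pos).2 (by simpa using hr1)
    · rw [Real.coe_toNNReal _ (Real.sqrt_nonneg _), Subtype.dist_eq, Subtype.dist_eq,
        dist_eq_norm, dist_eq_norm]
      exact hT z z.2 z' z'.2
  obtain ⟨z, hz, hfix, -⟩ := hcontr.exists_fixedPoint' hclosed.isComplete hmaps
    (x := WithLp.toLp 2 a) (fun i => left_mem_Icc.2 (hab i)) (edist_ne_top _ _)
  refine ⟨z, hz, fun i s hs => mul_sub_nonneg_of_projIcc_eq (hab i) hγpos ?_ hs⟩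
  exact congrArg (fun w : EuclideanSpace ℝ (Fin N) => w i) hfix

/-! ### Unique equilibrium of the bottom level -/

namespace DeceptionGame

variable {N m : ℕ} (G : DeceptionGame N m)

theorem isCompact_Ωz : IsCompact G.Ωz := by
  have h := (isCompact_univ_pi fun i => isCompact_Icc (a := G.zmin i) (b := G.zmax i)).image
    (PiLp.continuous_toLp 2 fun _ : Fin N => ℝ)
  convert h using 1
  ext z
  constructor
  · exact fun hz => ⟨WithLp.ofLp z, fun i _ => hz i, rfl⟩
  · rintro ⟨w, hw, rfl⟩ i
    exact hw i (mem_univ i)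

variable {G} in
theorem replaceCoord_mem_Ωz {z : EuclideanSpace ℝ (Fin N)} (hz : z ∈ G.Ωz) {i : Fin N} {t : ℝ}
    (ht : t ∈ G.Ωzi i) : replaceCoord z i t ∈ G.Ωz := by
  intro j
  by_cases h : j = i
  · subst h; simpa [replaceCoord] using ht
  · simpa [replaceCoord, h] using hz j

/-- `z` is a Nash equilibrium of the bottom-level followers, given `x` and `y`. -/
def IsBottomNash (θ : EuclideanSpace ℝ (Fin m)) (x y : ℝ) (z : EuclideanSpace ℝ (Fin N)) : Prop :=
  ∀ i, IsMaxOn (fun t => G.UZ i x y (replaceCoord z i t) θ) (G.Ωzi i) (z i)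

variable {G} {θ : EuclideanSpace ℝ (Fin m)}

theorem ConcaveSmooth.differentiableWithinAt_UZ (h : G.ConcaveSmooth) (hθ : θ ∈ G.Θ) (i : Fin N)
    {x y : ℝ} (hx : x ∈ G.Ωx) (hy : y ∈ G.Ωy) {z : EuclideanSpace ℝ (Fin N)} (hz : z ∈ G.Ωz) :
    DifferentiableWithinAt ℝ (fun t => G.UZ i x y (replaceCoord z i t) θ) (G.Ωzi i) (z i) := by
  have hmaps : MapsTo (fun t => (x, y, replaceCoord z i t)) (G.Ωzi i) (G.Ωx ×ˢ G.Ωy ×ˢ G.Ωz) :=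
    fun t ht => ⟨hx, hy, replaceCoord_mem_Ωz hz ht⟩
  have hd : Differentiable ℝ fun t : ℝ => (x, y, replaceCoord z i t) := by
    simp only [replaceCoord_eq_add_smul]
    fun_prop
  exact (((h.UZ_smooth θ hθ i).differentiableOn one_ne_zero).comp hd.differentiableOn hmaps)
    (z i) (hz i)

/-- `F` is minus the own derivative, and by concavity the first-order condition of each player is
also sufficient. -/
theorem ConcaveSmooth.isBottomNash_iff (h : G.ConcaveSmooth) (hθ : θ ∈ G.Θ)
    {x y : ℝ} (hx : x ∈ G.Ωx) (hy : y ∈ G.Ωy) {z : EuclideanSpace ℝ (Fin N)} (hz : z ∈ G.Ωz) :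
    G.IsBottomNash θ x y z ↔ ∀ i, ∀ s ∈ G.Ωzi i, 0 ≤ G.F x y z θ i * (s - z i) := by
  refine forall_congr' fun i => ?_
  have hd := h.differentiableWithinAt_UZ hθ i hx hy hz
  have hF : ∀ s, G.F x y z θ i * (s - z i) =
      -(derivWithin (fun t => G.UZ i x y (replaceCoord z i t) θ) (G.Ωzi i) (z i) * (s - z i)) :=
    fun s => neg_mul _ _
  simp only [hF, neg_nonneg]
  exact ⟨fun hm s hs => hm.derivWithin_mul_sub_nonpos hd (hz i) hs,
    (h.UZ_concave θ hθ i x hx y hy z hz).isMaxOn_of_derivWithin_mul_sub_nonpos hd (hz i)⟩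

theorem exists_isBottomNash (h : G.ConcaveSmooth) (hF : G.StronglyMonotonePG) (hθ : θ ∈ G.Θ)
    {x y : ℝ} (hx : x ∈ G.Ωx) (hy : y ∈ G.Ωy) : ∃ z ∈ G.Ωz, G.IsBottomNash θ x y z := by
  obtain ⟨μ, hμ, hmono⟩ := hF.strongly_monotone θ hθ x hx y hy
  obtain ⟨κ, hlip⟩ := hF.lipschitz θ hθ x hx y hy
  obtain ⟨z, hz, hvi⟩ := exists_solution_variationalInequality_box G.z_le hμ hmono hlip
  exact ⟨z, hz, (h.isBottomNash_iff hθ hx hy hz).2 hvi⟩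

theorem IsBottomNash.unique (h : G.ConcaveSmooth) (hF : G.StronglyMonotonePG) (hθ : θ ∈ G.Θ)
    {x y : ℝ} (hx : x ∈ G.Ωx) (hy : y ∈ G.Ωy) {z z' : EuclideanSpace ℝ (Fin N)}
    (hz : z ∈ G.Ωz) (hz' : z' ∈ G.Ωz) (hn : G.IsBottomNash θ x y z)
    (hn' : G.IsBottomNash θ x y z') : z = z' := by
  obtain ⟨μ, hμ, hmono⟩ := hF.strongly_monotone θ hθ x hx y hy
  rw [h.isBottomNash_iff hθ hx hy hz] at hn
  rw [h.isBottomNash_iff hθ hx hy hz'] at hn'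
  -- Each equilibrium is tested against the other and the two inequalities are added.
  have hinner : inner ℝ (G.F x y z θ - G.F x y z' θ) (z - z') ≤ 0 := by
    rw [PiLp.inner_apply]
    refine Finset.sum_nonpos fun i _ => ?_
    have h₁ := hn i (z' i) (hz' i)
    have h₂ := hn' i (z i) (hz i)
    simp only [PiLp.sub_apply, RCLike.inner_apply, conj_trivial]
    linarith
  have hsq : ‖z - z'‖ ^ 2 ≤ 0 := by
    by_contra! hc
    exact ((mul_pos hμ hc).trans_le ((hmono z hz z' hz').trans hinner)).false
  exact sub_eq_zero.1 (norm_eq_zero.1 (pow_eq_zero_iff two_ne_zero |>.1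
    (le_antisymm hsq (sq_nonneg _))))

/-! ### Compactness of the optimality sets -/

/-- The profiles in which both kinds of followers reply optimally. -/
def followersOptimal (G : DeceptionGame N m) (θ : EuclideanSpace ℝ (Fin m)) :
    Set (ℝ × ℝ × EuclideanSpace ℝ (Fin N)) :=
  {p ∈ G.Ωx ×ˢ G.Ωy ×ˢ G.Ωz |
    IsMaxOn (fun y => G.UY p.1 y θ) G.Ωy p.2.1 ∧ G.IsBottomNash θ p.1 p.2.1 p.2.2}

theorem ConcaveSmooth.isCompact_followersOptimal (h : G.ConcaveSmooth) (hθ : θ ∈ G.Θ) :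
    IsCompact (G.followersOptimal θ) := by
  have hΩ : IsCompact (G.Ωx ×ˢ G.Ωy ×ˢ G.Ωz) :=
    isCompact_Icc.prod (isCompact_Icc.prod G.isCompact_Ωz)
  have hUY := (h.UY_smooth θ hθ).continuousOn
  have hY : IsCompact {p ∈ G.Ωx ×ˢ G.Ωy ×ˢ G.Ωz |
      ∀ y : G.Ωy, G.UY p.1 y θ ≤ G.UY p.1 p.2.1 θ} := by
    refine hΩ.setOf_forall_le (fun y => ?_) fun _ => ?_
    · exact hUY.comp (f := fun p : ℝ × ℝ × EuclideanSpace ℝ (Fin N) => (p.1, (y : ℝ)))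
        (by fun_prop) fun p hp => ⟨hp.1, y.2⟩
    · exact hUY.comp (f := fun p : ℝ × ℝ × EuclideanSpace ℝ (Fin N) => (p.1, p.2.1))
        (by fun_prop) fun p hp => ⟨hp.1, hp.2.1⟩
  have hZ : IsCompact {p ∈ G.Ωx ×ˢ G.Ωy ×ˢ G.Ωz | ∀ k : Σ i, G.Ωzi i,
      G.UZ k.1 p.1 p.2.1 (replaceCoord p.2.2 k.1 k.2) θ ≤ G.UZ k.1 p.1 p.2.1 p.2.2 θ} := by
    refine hΩ.setOf_forall_le (fun k => ?_) fun k => (h.UZ_smooth θ hθ k.1).continuousOn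
    refine (h.UZ_smooth θ hθ k.1).continuousOn.comp
      (f := fun p : ℝ × ℝ × EuclideanSpace ℝ (Fin N) =>
        (p.1, p.2.1, replaceCoord p.2.2 k.1 k.2)) ?_
      fun p hp => ⟨hp.1, hp.2.1, replaceCoord_mem_Ωz hp.2.2 k.2.2⟩
    simp only [replaceCoord_eq_add_smul]
    fun_prop
  convert hY.inter hZ using 1
  ext p
  simp only [followersOptimal, IsBottomNash, isMaxOn_iff, replaceCoord_self, mem_ofPred_eq,
    mem_inter_iff, Subtype.forall, Sigma.forall]
  tauto

/-- The profiles with optimal followers in which the leader cannot gain by decreasing `x` (for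
`min`) or by increasing `x` (for `max`), projected to the decisions of `X` and `Y`. -/
def leaderOptimalTowards (G : DeceptionGame N m) (θ : EuclideanSpace ℝ (Fin m))
    (r : ℝ → ℝ → ℝ) : Set (ℝ × ℝ) :=
  (fun p => (p.1, p.2.1)) '' {p ∈ G.followersOptimal θ |
    ∀ x' : G.Ωx, G.UX (r x' p.1) p.2.1 p.2.2 G.θ₀ ≤ G.UX p.1 p.2.1 p.2.2 G.θ₀}

/-- Writing one-sided deviations as `min x' x` or `max x' x` makes the index set independent of `x`
and each constraint continuous. Compactness survives the projection, so continuity of the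
bottom-level reply in `(x, y)` is not needed. -/
theorem ConcaveSmooth.isCompact_leaderOptimalTowards (h : G.ConcaveSmooth) (hθ : θ ∈ G.Θ)
    {r : ℝ → ℝ → ℝ} (hr : ∀ s, Continuous (r s))
    (hrΩ : ∀ s ∈ G.Ωx, ∀ t ∈ G.Ωx, r s t ∈ G.Ωx) :
    IsCompact (G.leaderOptimalTowards θ r) := by
  refine IsCompact.image ?_ (by fun_prop)
  have hUX := h.UX_smooth.continuousOn
  refine (h.isCompact_followersOptimal hθ).setOf_forall_le (fun x' => ?_)
    fun _ => hUX.mono (sep_subset _ _)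
  refine hUX.comp (f := fun p : ℝ × ℝ × EuclideanSpace ℝ (Fin N) => (r x' p.1, p.2.1, p.2.2))
    ?_ fun p hp => ⟨hrΩ _ x'.2 _ hp.1.1, hp.1.2⟩
  have := hr x'
  fun_prop

theorem mem_leaderOptimalTowards {r : ℝ → ℝ → ℝ} {x y : ℝ} :
    (x, y) ∈ G.leaderOptimalTowards θ r ↔ ∃ z, (x, y, z) ∈ G.followersOptimal θ ∧
      ∀ x' : G.Ωx, G.UX (r x' x) y z G.θ₀ ≤ G.UX x y z G.θ₀ := by
  constructor
  · rintro ⟨⟨x, y, z⟩, hp, ⟨⟩⟩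
    exact ⟨z, hp⟩
  · rintro ⟨z, hp⟩
    exact ⟨(x, y, z), hp, rfl⟩

/-! ### Existence of the equilibrium -/

theorem exists_isHNE (h : G.ConcaveSmooth) (hF : G.StronglyMonotonePG) (hθ : θ ∈ G.Θ) :
    ∃ (x y : ℝ) (z : EuclideanSpace ℝ (Fin N)), G.IsHNE θ x y z := by
  let Y : ℝ → Set ℝ := fun x => {y ∈ G.Ωy | IsMaxOn (fun y' => G.UY x y' θ) G.Ωy y}
  have hYne : ∀ x ∈ G.Ωx, (Y x).Nonempty := fun x hx =>
    isCompact_Icc.exists_isMaxOn (nonempty_Icc.2 G.y_le)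
      ((h.UY_smooth θ hθ).continuousOn.comp (f := fun y => (x, y)) (by fun_prop)
        fun y hy => ⟨hx, hy⟩)
  have hYconn : ∀ x ∈ G.Ωx, IsPreconnected (Y x) := by
    intro x hx
    obtain ⟨y₀, hy₀, hmax⟩ := hYne x hx
    -- As a superlevel set of a concave function, the reply set is convex.
    have hYx : Y x = {y ∈ G.Ωy | G.UY x y₀ θ ≤ G.UY x y θ} := by
      ext y
      exact and_congr_right fun _ => ⟨fun hm => hm hy₀, fun hle y' hy' => (hmax hy').trans hle⟩
    rw [hYx]
    exact ((h.UY_concave θ hθ x hx).convex_ge _).isPreconnected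
  have hfol : ∀ x ∈ G.Ωx, ∀ y ∈ Y x, ∃ z, (x, y, z) ∈ G.followersOptimal θ := by
    intro x hx y hy
    obtain ⟨z, hz, hn⟩ := exists_isBottomNash h hF hθ hx hy.1
    exact ⟨z, ⟨hx, hy.1, hz⟩, hy.2, hn⟩
  have hsub : ∀ r, ∀ p ∈ G.leaderOptimalTowards θ r, p.2 ∈ Y p.1 := by
    rintro r _ ⟨p, hp, rfl⟩
    exact ⟨hp.1.1.2.1, hp.1.2.1⟩
  have hleft : G.xmin ∈ G.Ωx := left_mem_Icc.2 G.x_le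
  have hright : G.xmax ∈ G.Ωx := right_mem_Icc.2 G.x_le
  obtain ⟨⟨x, y⟩, hA, hB⟩ := inter_nonempty_of_cover_graph G.x_le
    (h.isCompact_leaderOptimalTowards hθ (r := min) (by fun_prop)
      fun s hs t ht => ⟨le_min hs.1 ht.1, (min_le_left _ _).trans hs.2⟩)
    (h.isCompact_leaderOptimalTowards hθ (r := max) (by fun_prop)
      fun s hs t ht => ⟨hs.1.trans (le_max_left _ _), max_le hs.2 ht.2⟩)
    hYne hYconn
    (fun x hx y hy => by
      obtain ⟨z, hz⟩ := hfol x hx y hy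
      exact (h.UX_concave y hy.1 z hz.1.2.2).forall_min_le_or_forall_max_le.imp
        (fun hl => mem_leaderOptimalTowards.2 ⟨z, hz, hl⟩)
        (fun hl => mem_leaderOptimalTowards.2 ⟨z, hz, hl⟩))
    (hsub min) (hsub max)
    -- At `xmin` no smaller decision exists, so the constraint with `min` is trivial; symmetrically
    -- at `xmax`.
    (by
      obtain ⟨y, hy⟩ := hYne _ hleft
      obtain ⟨z, hz⟩ := hfol _ hleft y hy
      exact ⟨y, mem_leaderOptimalTowards.2 ⟨z, hz, fun x' => by rw [min_eq_right x'.2.1]⟩⟩)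
    (by
      obtain ⟨y, hy⟩ := hYne _ hright
      obtain ⟨z, hz⟩ := hfol _ hright y hy
      exact ⟨y, mem_leaderOptimalTowards.2 ⟨z, hz, fun x' => by rw [max_eq_right x'.2.2]⟩⟩)
  obtain ⟨z, ⟨⟨hx, hy, hz⟩, hYmax, hZmax⟩, hmin⟩ := mem_leaderOptimalTowards.1 hA
  obtain ⟨z', ⟨⟨-, -, hz'⟩, -, hZmax'⟩, hmax⟩ := mem_leaderOptimalTowards.1 hB
  -- The two memberships come with their own bottom-level profiles; uniqueness lets both one-sided
  -- conditions refer to the same one.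
  obtain rfl : z = z' := hZmax.unique h hF hθ hx hy hz hz' hZmax'
  refine ⟨x, y, z, ⟨hx, fun x' hx' => ?_⟩, ⟨hy, hYmax⟩, fun i => ⟨hz i, hZmax i⟩⟩
  rcases le_total x' x with hle | hle
  · simpa [min_eq_left hle] using hmin ⟨x', hx'⟩
  · simpa [max_eq_left hle] using hmax ⟨x', hx'⟩

end DeceptionGame

theorem mainTheorem8 {N m : ℕ} (G : DeceptionGame N m)
    (hconcave : G.ConcaveSmooth) (hmonotone : G.StronglyMonotonePG) (htame : G.TameRegular) :
    ∀ θ ∈ G.Θ, ∃ (x y : ℝ) (z : EuclideanSpace ℝ (Fin N)), G.IsHNE θ x y z :=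
  fun _ hθ => DeceptionGame.exists_isHNE hconcave hmonotone hθ
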